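/- Let $SE(3)=SO(3)\ltimes\mathbb{R}^3$ be the group of displacements $x\mapsto Rx+r$ of Euclidean 3-space ($R\in SO(3)$, $r\in\mathbb{R}^3$). It acts on its Lie algebra $\mathfrak{se}(3)\cong\mathbb{R}^3\times\mathbb{R}^3$, whose elements $(\omega,v)$ are called screws, by the adjoint action $(R,r)\cdot(\omega,v)=(R\omega,\ r\times R\omega+Rv)$. Let $SE(3)$ act diagonally on pairs of screws $(\omega_1,v_1,\omega_2,v_2)\in\mathbb{R}^{12}$, and let $\mathbb{R}[\omega_1,v_1,\omega_2,v_2]^{SE(3)}$ be the ring of those real polynomials $f$ in the 12 coordinates that satisfy $f(g\cdot s)=f(s)$ for all $g\in SE(3)$ and all pairs of screws $s$. Then $\mathbb{R}[\omega_1,v_1,\omega_2,v_2]^{SE(3)}$ is generated, as an $\mathbb{R}$-algebra, by $$\omega_i\cdot\omega_j\ (1\le i,j\le 2),\qquad \omega_1\cdot v_1,\quad \omega_2\cdot v_2,\qquad \omega_1\cdot v_2+\omega_2\cdot v_1 .$$ -/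

import Mathlib

open Matrix MvPolynomial

namespace Screws

/-- The special Euclidean group `SE(3) = SO(3) ⋉ ℝ³`: a pair `(R, r)` is the displacement
`x ↦ R x + r` of Euclidean 3-space. -/
@[ext]
structure SE3 where
  /-- the rotation part `R` -/
  rot : Matrix.specialOrthogonalGroup (Fin 3) ℝ
  /-- the translation part `r` -/
  trans : Fin 3 → ℝ

namespace SE3

/-- Composition of displacements. -/
instance : Mul SE3 where
  mul g h := ⟨g.rot * h.rot, (g.rot : Matrix (Fin 3) (Fin 3) ℝ) *ᵥ h.trans + g.trans⟩

instance : One SE3 where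
  one := ⟨1, 0⟩

instance : Inv SE3 where
  inv g := ⟨g.rot⁻¹, -(((g.rot⁻¹ : Matrix.specialOrthogonalGroup (Fin 3) ℝ) :
    Matrix (Fin 3) (Fin 3) ℝ) *ᵥ g.trans)⟩

@[simp] theorem mul_rot (g h : SE3) : (g * h).rot = g.rot * h.rot := rfl

@[simp] theorem mul_trans (g h : SE3) :
    (g * h).trans = (g.rot : Matrix (Fin 3) (Fin 3) ℝ) *ᵥ h.trans + g.trans := rfl

@[simp] theorem one_rot : (1 : SE3).rot = 1 := rfl

@[simp] theorem one_trans : (1 : SE3).trans = 0 := rfl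

@[simp] theorem inv_rot (g : SE3) : (g⁻¹).rot = g.rot⁻¹ := rfl

@[simp] theorem inv_trans (g : SE3) :
    (g⁻¹).trans = -(((g.rot⁻¹ : Matrix.specialOrthogonalGroup (Fin 3) ℝ) :
      Matrix (Fin 3) (Fin 3) ℝ) *ᵥ g.trans) := rfl

instance : Group SE3 :=
  Group.ofLeftAxioms
    (fun a b c => by
      apply SE3.ext
      · simp [mul_assoc]
      · simp [Matrix.mulVec_add, add_assoc])
    (fun a => by
      apply SE3.ext
      · simp
      · simp)
    (fun a => by
      apply SE3.ext
      · simp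
      · simp)

end SE3

/-- The skew-symmetric matrix `T` of a vector `t`, so that `T x = t × x`. -/
def skew (t : Fin 3 → ℝ) : Matrix (Fin 3) (Fin 3) ℝ :=
  !![0, -t 2, t 1; t 2, 0, -t 0; -t 1, t 0, 0]

/-- A screw (twist), that is an element of the Lie algebra `se(3)`, given by its Plücker
coordinates `(ω, v)`; it stands for the pair `(Ω, v)` with `Ω = skew ω`. -/
@[ext]
structure Screw where
  /-- the rotational part -/
  ω : Fin 3 → ℝ
  /-- the translational part -/
  v : Fin 3 → ℝ

theorem transpose_mul_skew_mul (M : Matrix (Fin 3) (Fin 3) ℝ) (t : Fin 3 → ℝ) :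
    Mᵀ * skew (M *ᵥ t) * M = M.det • skew t := by
  ext i j
  fin_cases i <;> fin_cases j <;>
    simp [skew, Matrix.mul_apply, Fin.sum_univ_three, Matrix.mulVec, dotProduct,
      Matrix.det_fin_three] <;> ring

theorem skew_mulVec_mul (R : Matrix.specialOrthogonalGroup (Fin 3) ℝ) (t : Fin 3 → ℝ) :
    skew ((R : Matrix (Fin 3) (Fin 3) ℝ) *ᵥ t) * (R : Matrix (Fin 3) (Fin 3) ℝ) =
      (R : Matrix (Fin 3) (Fin 3) ℝ) * skew t := by
  obtain ⟨M, hM⟩ := R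
  obtain ⟨hO, hdet⟩ := Matrix.mem_specialOrthogonalGroup_iff.1 hM
  have hMM : M * Mᵀ = 1 := (Matrix.mem_orthogonalGroup_iff (Fin 3) ℝ).1 hO
  have h := transpose_mul_skew_mul M t
  rw [hdet, one_smul] at h
  change skew (M *ᵥ t) * M = M * skew t
  rw [← h, ← Matrix.mul_assoc, ← Matrix.mul_assoc, hMM, Matrix.one_mul]

theorem skew_add (s t : Fin 3 → ℝ) : skew (s + t) = skew s + skew t := by
  ext i j
  fin_cases i <;> fin_cases j <;> simp [skew] <;> ring

theorem skew_zero : skew 0 = 0 := by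
  ext i j
  fin_cases i <;> fin_cases j <;> simp [skew]

/-- The adjoint action of `SE(3)` on its Lie algebra, in Plücker coordinates: with `T = skew r`,
`(R, r) • (ω, v) = (R ω, T R ω + R v)`. -/
instance : SMul SE3 Screw where
  smul g s :=
    ⟨(g.rot : Matrix (Fin 3) (Fin 3) ℝ) *ᵥ s.ω,
      (skew g.trans * (g.rot : Matrix (Fin 3) (Fin 3) ℝ)) *ᵥ s.ω +
        (g.rot : Matrix (Fin 3) (Fin 3) ℝ) *ᵥ s.v⟩

@[simp] theorem smul_ω (g : SE3) (s : Screw) :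
    (g • s).ω = (g.rot : Matrix (Fin 3) (Fin 3) ℝ) *ᵥ s.ω := rfl

@[simp] theorem smul_v (g : SE3) (s : Screw) :
    (g • s).v = (skew g.trans * (g.rot : Matrix (Fin 3) (Fin 3) ℝ)) *ᵥ s.ω +
      (g.rot : Matrix (Fin 3) (Fin 3) ℝ) *ᵥ s.v := rfl

instance : MulAction SE3 Screw where
  one_smul s := by
    apply Screw.ext
    · simp
    · simp [skew_zero]
  mul_smul g h s := by
    apply Screw.ext
    · simp
    · simp only [smul_v, smul_ω, SE3.mul_trans, SE3.mul_rot, Submonoid.coe_mul, skew_add,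
        Matrix.add_mul, Matrix.add_mulVec, Matrix.mulVec_add, Matrix.mulVec_mulVec]
      rw [← Matrix.mul_assoc (skew _), skew_mulVec_mul]
      simp only [Matrix.mul_assoc]
      abel

/-- The coordinates of a `k`-screw: `(i, Sum.inl n)` labels the `n`-th coordinate of `ωᵢ`, and
`(i, Sum.inr n)` the `n`-th coordinate of `vᵢ`. -/
abbrev Coord (k : ℕ) : Type := Fin k × (Fin 3 ⊕ Fin 3)

/-- The point of `ℝ^(6k)` with the Plücker coordinates of a `k`-screw. -/
def coords {k : ℕ} (s : Fin k → Screw) : Coord k → ℝ :=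
  fun c => Sum.elim (s c.1).ω (s c.1).v c.2

/-- The ring of polynomial invariants of `SE(3)` acting diagonally by the adjoint action on
`k`-screws: the polynomials `f` with `f (g • s) = f s` for all `g` and `s`. -/
noncomputable def invariantRing (k : ℕ) : Subalgebra ℝ (MvPolynomial (Coord k) ℝ) where
  carrier := {f | ∀ (g : SE3) (s : Fin k → Screw), eval (coords (g • s)) f = eval (coords s) f}
  mul_mem' := by
    intro a b ha hb g s
    rw [map_mul, map_mul, ha g s, hb g s]
  add_mem' := by
    intro a b ha hb g s
    rw [map_add, map_add, ha g s, hb g s]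
  algebraMap_mem' := by
    intro r g s
    simp [MvPolynomial.algebraMap_eq]

/-- The vector `ωᵢ` of coordinate polynomials. -/
noncomputable def omegaVar {k : ℕ} (i : Fin k) : Fin 3 → MvPolynomial (Coord k) ℝ :=
  fun n => X (i, Sum.inl n)

/-- The vector `vᵢ` of coordinate polynomials. -/
noncomputable def vVar {k : ℕ} (i : Fin k) : Fin 3 → MvPolynomial (Coord k) ℝ :=
  fun n => X (i, Sum.inr n)

end Screws

/-!
The six generators separate the orbits of `SE(3)` on the pairs of screws for which the Gram
determinant of `ω₁, ω₂` is nonzero, so an invariant `f` is determined by its values on any section.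
Screw motions about the axis of the second screw preserve the generators and `f`, and by analytic
continuation so do those with a complex parameter; one of the latter brings the pair to a normal
form in which the two components of `ω₁` across this axis satisfy `x + i y = 1`. The coordinates of
this normal form are polynomials in the generators and `t = √(ω₂ · ω₂)`, up to powers of `ω₂ · ω₂`
in the denominators. Averaging over the two signs of `t` and taking real parts shows that
`(ω₂ · ω₂) ^ N * f` is a polynomial in the generators, and so is `(ω₁ · ω₁) ^ M * f` by symmetry.
The generators are algebraically independent, so `ω₁ · ω₁` and `ω₂ · ω₂` are coprime in the ring
they generate, and both denominators cancel.
-/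

namespace Screws

section Algebra

theorem mem_range_of_pow_mul_mem_range {A B : Type*} [CommRing A] [CommRing B] [IsDomain B]
    {φ : A →+* B} (hφ : Function.Injective φ) {p q : A} (hp : Prime p) (hpq : ¬p ∣ q)
    {f : B} {m n : ℕ} (hpf : φ p ^ m * f ∈ φ.range) (hqf : φ q ^ n * f ∈ φ.range) :
    f ∈ φ.range := by
  have : IsDomain A := hφ.isDomain φ
  obtain ⟨P, hP⟩ := hpf
  obtain ⟨Q, hQ⟩ := hqf
  have hPQ : q ^ n * P = p ^ m * Q := hφ (by
    simp only [map_mul, map_pow, hP, hQ]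
    ring)
  obtain ⟨P', rfl⟩ : p ^ m ∣ P :=
    hp.pow_dvd_of_dvd_mul_left m (fun h => hpq (hp.dvd_of_dvd_pow h)) ⟨Q, hPQ⟩
  have hpm : φ p ^ m ≠ 0 := pow_ne_zero m ((map_ne_zero_iff φ hφ).2 hp.ne_zero)
  exact ⟨P', mul_left_cancel₀ hpm (by simpa only [map_mul, map_pow] using hP)⟩

theorem exists_pow_mul_eval_eq_add_mul {R σ ι Θ : Type*} [CommRing R] {x : Θ → ι → R}
    {t : Θ → R} {p : Θ → σ → R} {c u : MvPolynomial ι R} (ht : ∀ θ, t θ ^ 2 = eval (x θ) c)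
    (hp : ∀ i, ∃ G H : MvPolynomial ι R, ∀ θ,
      eval (x θ) u * p θ i = eval (x θ) G + t θ * eval (x θ) H) (f : MvPolynomial σ R) :
    ∃ (N : ℕ) (G H : MvPolynomial ι R), ∀ θ,
      eval (x θ) u ^ N * eval (p θ) f = eval (x θ) G + t θ * eval (x θ) H := by
  induction f using MvPolynomial.induction_on with
  | C r => exact ⟨0, C r, 0, fun θ => by simp⟩
  | add f₁ f₂ hf₁ hf₂ =>
    obtain ⟨N₁, G₁, H₁, h₁⟩ := hf₁
    obtain ⟨N₂, G₂, H₂, h₂⟩ := hf₂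
    refine ⟨N₁ + N₂, u ^ N₂ * G₁ + u ^ N₁ * G₂, u ^ N₂ * H₁ + u ^ N₁ * H₂, fun θ => ?_⟩
    simp only [map_add, map_mul, map_pow]
    linear_combination eval (x θ) u ^ N₂ * h₁ θ + eval (x θ) u ^ N₁ * h₂ θ
  | mul_X f i hf =>
    obtain ⟨N, G, H, h⟩ := hf
    obtain ⟨G', H', h'⟩ := hp i
    refine ⟨N + 1, G * G' + c * H * H', G * H' + H * G', fun θ => ?_⟩
    simp only [map_add, map_mul, eval_X, ← ht, pow_succ, mul_mul_mul_comm _ (eval (x θ) u), h, h']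
    ring

theorem exists_eval_eq_re {ι : Type*} (G : MvPolynomial ι ℂ) :
    ∃ Q : MvPolynomial ι ℝ, ∀ x : ι → ℝ, eval x Q = (eval (fun i => (x i : ℂ)) G).re := by
  induction G using MvPolynomial.induction_on with
  | C z => exact ⟨C z.re, fun x => by simp⟩
  | add G₁ G₂ h₁ h₂ =>
    obtain ⟨Q₁, h₁⟩ := h₁
    obtain ⟨Q₂, h₂⟩ := h₂
    exact ⟨Q₁ + Q₂, fun x => by simp [h₁, h₂]⟩
  | mul_X G i h =>
    obtain ⟨Q, h⟩ := h
    exact ⟨Q * X i, fun x => by simp [h]⟩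

theorem eq_of_forall_ofReal_eq {F : ℂ → ℂ} (hF : AnalyticOnNhd ℂ F Set.univ) {a : ℂ}
    (h : ∀ x : ℝ, F x = a) (z : ℂ) : F z = a := by
  have hreal : ∃ᶠ w in nhdsWithin (0 : ℂ) {0}ᶜ, F w = a := by
    have hlim : Filter.Tendsto ((↑) : ℝ → ℂ) (nhdsWithin 0 {0}ᶜ) (nhdsWithin 0 {0}ᶜ) :=
      Complex.continuous_ofReal.continuousAt.tendsto.inf <| by simp
    exact hlim.frequently (Filter.Frequently.of_forall h)
  exact congrFun (hF.eq_of_frequently_eq analyticOnNhd_const hreal) z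

end Algebra

section Frame

theorem mulVec_dotProduct_mulVec {n R : Type*} [Fintype n] [DecidableEq n] [CommRing R]
    {M : Matrix n n R} (hM : M ∈ orthogonalGroup n R) (x y : n → R) :
    M *ᵥ x ⬝ᵥ M *ᵥ y = x ⬝ᵥ y := by
  rw [dotProduct_mulVec, ← mulVec_transpose, mulVec_mulVec,
    (mem_orthogonalGroup_iff' n R).1 hM, one_mulVec]

variable {K : Type*} [Field K]

/-- The matrix with rows `u`, `w` and `u × w`, invertible as soon as the Gram determinant of
`u, w` is nonzero; it is used to transport one pair of vectors to another. -/
def frame (u w : Fin 3 → K) : Matrix (Fin 3) (Fin 3) K := ![u, w, u ⨯₃ w]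

theorem det_frame (u w : Fin 3 → K) :
    (frame u w).det = u ⬝ᵥ u * w ⬝ᵥ w - (u ⬝ᵥ w) ^ 2 := by
  rw [frame, ← triple_product_eq_det, triple_product_permutation, triple_product_permutation,
    cross_dot_cross, dotProduct_comm w u, sq]

theorem frame_mul_transpose (u w : Fin 3 → K) :
    frame u w * (frame u w)ᵀ =
      !![u ⬝ᵥ u, u ⬝ᵥ w, 0;
        u ⬝ᵥ w, w ⬝ᵥ w, 0;
        0, 0, u ⬝ᵥ u * w ⬝ᵥ w - (u ⬝ᵥ w) ^ 2] := by
  have hentry (i j) : (frame u w * (frame u w)ᵀ) i j = frame u w i ⬝ᵥ frame u w j := rfl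
  ext i j
  rw [hentry]
  fin_cases i <;> fin_cases j <;>
    simp [frame, dot_self_cross, dot_cross_self, cross_dot_cross, dotProduct_comm (u ⨯₃ w),
      dotProduct_comm w u, sq]

theorem eq_of_dotProduct_eq {u w : Fin 3 → K} (hgram : u ⬝ᵥ u * w ⬝ᵥ w - (u ⬝ᵥ w) ^ 2 ≠ 0)
    {x y : Fin 3 → K} (hu : u ⬝ᵥ x = u ⬝ᵥ y) (hw : w ⬝ᵥ x = w ⬝ᵥ y)
    (hc : u ⨯₃ w ⬝ᵥ x = u ⨯₃ w ⬝ᵥ y) : x = y := by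
  have hdet : IsUnit (frame u w) :=
    (isUnit_iff_isUnit_det _).2 (det_frame u w ▸ hgram.isUnit)
  refine mulVec_injective_of_isUnit hdet (funext fun i => ?_)
  fin_cases i
  exacts [hu, hw, hc]

theorem exists_specialOrthogonal_mulVec_eq {u w u' w' : Fin 3 → K} (huu : u ⬝ᵥ u = u' ⬝ᵥ u')
    (huw : u ⬝ᵥ w = u' ⬝ᵥ w') (hww : w ⬝ᵥ w = w' ⬝ᵥ w')
    (hgram : u ⬝ᵥ u * w ⬝ᵥ w - (u ⬝ᵥ w) ^ 2 ≠ 0) :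
    ∃ M ∈ specialOrthogonalGroup (Fin 3) K, M *ᵥ u = u' ∧ M *ᵥ w = w' := by
  set F := frame u w
  set F' := frame u' w'
  have hdetF : F.det ≠ 0 := det_frame u w ▸ hgram
  have hFunit : IsUnit F.det := hdetF.isUnit
  have hFF' : F' * F'ᵀ = F * Fᵀ := by
    rw [frame_mul_transpose, frame_mul_transpose, huu, huw, hww]
  let M := F'ᵀ * F⁻¹ᵀ
  have hMF : M * Fᵀ = F'ᵀ := by
    rw [mul_assoc, ← transpose_mul, mul_nonsing_inv F hFunit,
      transpose_one, mul_one]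
  have horth : Mᵀ * M = 1 := calc
    Mᵀ * M = F⁻¹ * (F' * F'ᵀ) * F⁻¹ᵀ := by
      simp only [M, transpose_mul, transpose_transpose, mul_assoc]
    _ = (F⁻¹ * F) * (F⁻¹ * F)ᵀ := by
      simp only [hFF', transpose_mul, mul_assoc]
    _ = 1 := by rw [nonsing_inv_mul F hFunit, transpose_one, mul_one]
  have hdet : M.det = 1 := by
    have h := congrArg det hMF
    rw [det_mul, det_transpose, det_transpose,
      show F'.det = F.det by rw [det_frame, det_frame, huu, huw, hww]] at h
    exact mul_right_cancel₀ hdetF (h.trans (one_mul _).symm)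
  refine ⟨M, mem_specialOrthogonalGroup_iff.2
    ⟨(mem_orthogonalGroup_iff' (Fin 3) K).2 horth, hdet⟩, ?_, ?_⟩
  · exact funext fun i => congrFun (congrFun hMF i) 0
  · exact funext fun i => congrFun (congrFun hMF i) 1

theorem exists_cross_eq {u w p q : Fin 3 → K} (hgram : u ⬝ᵥ u * w ⬝ᵥ w - (u ⬝ᵥ w) ^ 2 ≠ 0)
    (hp : u ⬝ᵥ p = 0) (hq : w ⬝ᵥ q = 0) (hpq : u ⬝ᵥ q + w ⬝ᵥ p = 0) :
    ∃ r : Fin 3 → K, r ⨯₃ u = p ∧ r ⨯₃ w = q := by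
  set d := u ⬝ᵥ u * w ⬝ᵥ w - (u ⬝ᵥ w) ^ 2 with hd
  obtain ⟨n, hn⟩ : ∃ n, n = u ⨯₃ w := ⟨_, rfl⟩
  have hun : u ⬝ᵥ n = 0 := by rw [hn, dot_self_cross]
  have hwn : w ⬝ᵥ n = 0 := by rw [hn, dot_cross_self]
  have hnn : n ⬝ᵥ n = d := by rw [hn, cross_dot_cross, dotProduct_comm w u, hd, sq]
  have hwu : w ⨯₃ u = -n := hn ▸ (cross_anticomm u w).symm
  have hwnu : w ⬝ᵥ n ⨯₃ u = d := by
    rw [← triple_product_permutation, ← triple_product_permutation, ← hn, hnn]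
  have hunw : u ⬝ᵥ n ⨯₃ w = -d := by
    rw [← triple_product_permutation, ← triple_product_permutation, hwu, dotProduct_neg, hnn]
  refine ⟨d⁻¹ • ((n ⬝ᵥ q) • u - (n ⬝ᵥ p) • w + (w ⬝ᵥ p) • n),
    eq_of_dotProduct_eq hgram ?_ ?_ ?_, eq_of_dotProduct_eq hgram ?_ ?_ ?_⟩
  · simp [hwu, hun, hp]
  · simp [hwu, hwn, hwnu, hgram, mul_comm _ d]
  · simp [hwu, hnn, ← hn, hgram, mul_comm _ d]
  · simpa [hun, hunw, ← hn, hgram, mul_comm _ d] using (eq_neg_of_add_eq_zero_left hpq).symm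
  · simp [hwn, ← hn, hq]
  · simp [hnn, ← hn, hgram, mul_comm _ d]

end Frame

section Invariants

/-- The six generating invariants, in the order
`ω₁·ω₁, ω₁·ω₂, ω₂·ω₂, ω₁·v₁, ω₂·v₂, ω₁·v₂ + ω₂·v₁`. -/
noncomputable def gens : Fin 6 → MvPolynomial (Coord 2) ℝ :=
  ![omegaVar 0 ⬝ᵥ omegaVar 0, omegaVar 0 ⬝ᵥ omegaVar 1, omegaVar 1 ⬝ᵥ omegaVar 1,
    omegaVar 0 ⬝ᵥ vVar 0, omegaVar 1 ⬝ᵥ vVar 1,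
    omegaVar 0 ⬝ᵥ vVar 1 + omegaVar 1 ⬝ᵥ vVar 0]

theorem adjoin_eq_range_aeval_gens :
    Algebra.adjoin ℝ
        ({p | ∃ i j : Fin 2, p = omegaVar i ⬝ᵥ omegaVar j} ∪
          {p | ∃ i : Fin 2, p = omegaVar i ⬝ᵥ vVar i} ∪
          {omegaVar 0 ⬝ᵥ vVar 1 + omegaVar 1 ⬝ᵥ vVar 0}) =
      (aeval (R := ℝ) gens).range := by
  rw [← Algebra.adjoin_range_eq_range_aeval]
  congr 1
  ext p
  constructor
  · rintro ((⟨i, j, rfl⟩ | ⟨i, rfl⟩) | rfl)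
    · fin_cases i <;> fin_cases j
      exacts [⟨0, rfl⟩, ⟨1, rfl⟩, ⟨1, dotProduct_comm (omegaVar 0) (omegaVar 1)⟩, ⟨2, rfl⟩]
    · fin_cases i
      exacts [⟨3, rfl⟩, ⟨4, rfl⟩]
    · exact ⟨5, rfl⟩
  · rintro ⟨i, rfl⟩
    fin_cases i
    exacts [.inl (.inl ⟨0, 0, rfl⟩), .inl (.inl ⟨0, 1, rfl⟩), .inl (.inl ⟨1, 1, rfl⟩),
      .inl (.inr ⟨0, rfl⟩), .inl (.inr ⟨1, rfl⟩), .inr rfl]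

/-- The values of the six invariants `gens` at a pair of screws. -/
def invariants (s : Fin 2 → Screw) : Fin 6 → ℝ :=
  ![(s 0).ω ⬝ᵥ (s 0).ω, (s 0).ω ⬝ᵥ (s 1).ω, (s 1).ω ⬝ᵥ (s 1).ω,
    (s 0).ω ⬝ᵥ (s 0).v, (s 1).ω ⬝ᵥ (s 1).v, (s 0).ω ⬝ᵥ (s 1).v + (s 1).ω ⬝ᵥ (s 0).v]

theorem eval_gens (s : Fin 2 → Screw) (i : Fin 6) :
    eval (coords s) (gens i) = invariants s i := by
  fin_cases i <;> simp [gens, invariants, omegaVar, vVar, coords, dotProduct]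

theorem eval_aeval_gens (s : Fin 2 → Screw) (P : MvPolynomial (Fin 6) ℝ) :
    eval (coords s) (aeval gens P) = eval (invariants s) P := by
  rw [map_aeval, algebraMap_eq, eval, eval₂Hom_comp_C,
    ← funext (eval_gens s)]
  rfl

theorem skew_mulVec (t x : Fin 3 → ℝ) : skew t *ᵥ x = t ⨯₃ x := by
  ext i
  fin_cases i <;> simp [skew, mulVec, dotProduct, Fin.sum_univ_three, cross_apply] <;> ring

theorem smul_v_eq_cross (g : SE3) (s : Screw) :
    (g • s).v = g.trans ⨯₃ (g • s).ω + (g.rot : Matrix (Fin 3) (Fin 3) ℝ) *ᵥ s.v := by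
  rw [smul_v, smul_ω, ← mulVec_mulVec, skew_mulVec]

theorem smul_ω_dotProduct_smul_ω (g : SE3) (s s' : Screw) :
    (g • s).ω ⬝ᵥ (g • s').ω = s.ω ⬝ᵥ s'.ω :=
  mulVec_dotProduct_mulVec g.rot.2.1 s.ω s'.ω

theorem smul_ω_dotProduct_smul_v (g : SE3) (s s' : Screw) :
    (g • s).ω ⬝ᵥ (g • s').v = g.trans ⬝ᵥ (g • s').ω ⨯₃ (g • s).ω + s.ω ⬝ᵥ s'.v := by
  rw [smul_v_eq_cross, dotProduct_add, triple_product_permutation, smul_ω g s,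
    mulVec_dotProduct_mulVec g.rot.2.1]

theorem invariants_smul (g : SE3) (s : Fin 2 → Screw) : invariants (g • s) = invariants s := by
  have hself (i : Fin 2) : (g • s i).ω ⬝ᵥ (g • s i).v = (s i).ω ⬝ᵥ (s i).v := by
    rw [smul_ω_dotProduct_smul_v, cross_self, dotProduct_zero, zero_add]
  have hmixed : (g • s 0).ω ⬝ᵥ (g • s 1).v + (g • s 1).ω ⬝ᵥ (g • s 0).v =
      (s 0).ω ⬝ᵥ (s 1).v + (s 1).ω ⬝ᵥ (s 0).v := by
    rw [smul_ω_dotProduct_smul_v, smul_ω_dotProduct_smul_v, ← cross_anticomm, dotProduct_neg]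
    ring
  simp only [invariants, Pi.smul_apply, smul_ω_dotProduct_smul_ω, hself, hmixed]

theorem range_aeval_gens_le : (aeval (R := ℝ) gens).range ≤ invariantRing 2 := by
  rintro _ ⟨P, rfl⟩ g s
  exact (eval_aeval_gens _ P).trans (invariants_smul g s ▸ (eval_aeval_gens s P).symm)

/-- The Gram determinant of `ω₁, ω₂` in terms of the six invariants `I`; taking `I = gens` gives
the corresponding polynomial. -/
def gramDet {R : Type*} [CommRing R] (I : Fin 6 → R) : R := I 0 * I 2 - I 1 ^ 2

theorem eval_gramDet_gens (s : Fin 2 → Screw) :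
    eval (coords s) (gramDet gens) = gramDet (invariants s) := by
  simp only [gramDet, map_sub, map_mul, map_pow, eval_gens]

theorem gramDet_gens_ne_zero : gramDet gens ≠ 0 := fun h => by
  have h₁ := eval_gramDet_gens ![⟨![1, 0, 0], 0⟩, ⟨![0, 1, 0], 0⟩]
  rw [h] at h₁
  simp [gramDet, invariants] at h₁

/-- The `k`-screw with a given point of `ℝ^(6k)` as its coordinates; the inverse of `coords`. -/
def ofCoords {k : ℕ} (w : Coord k → ℝ) : Fin k → Screw :=
  fun i => ⟨fun n => w (i, .inl n), fun n => w (i, .inr n)⟩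

theorem coords_ofCoords {k : ℕ} (w : Coord k → ℝ) : coords (ofCoords w) = w := by
  ext ⟨i, n | n⟩ <;> rfl

theorem eq_of_eval_coords_eq {f g : MvPolynomial (Coord 2) ℝ}
    (h : ∀ s, gramDet (invariants s) ≠ 0 → eval (coords s) f = eval (coords s) g) : f = g := by
  refine mul_left_cancel₀ gramDet_gens_ne_zero (MvPolynomial.funext fun w => ?_)
  rw [← coords_ofCoords w, map_mul, map_mul, eval_gramDet_gens]
  by_cases hw : gramDet (invariants (ofCoords w)) = 0
  · rw [hw, zero_mul, zero_mul]
  · rw [h _ hw]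

theorem exists_smul_eq_of_invariants_eq {s s' : Fin 2 → Screw}
    (hinv : invariants s = invariants s') (hgram : gramDet (invariants s) ≠ 0) :
    ∃ g : SE3, g • s = s' := by
  have hI (i : Fin 6) : invariants s i = invariants s' i := congrFun hinv i
  obtain ⟨M, hM, h₀, h₁⟩ := exists_specialOrthogonal_mulVec_eq (hI 0) (hI 1) (hI 2) hgram
  have hrot {x y : Fin 3 → ℝ} : M *ᵥ x ⬝ᵥ M *ᵥ y = x ⬝ᵥ y := mulVec_dotProduct_mulVec hM.1 x y
  obtain ⟨r, hr₀, hr₁⟩ := exists_cross_eq (u := (s' 0).ω) (w := (s' 1).ω)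
    (p := (s' 0).v - M *ᵥ (s 0).v) (q := (s' 1).v - M *ᵥ (s 1).v) (by rwa [hinv] at hgram)
    (by rw [dotProduct_sub, ← h₀, hrot, h₀]; exact sub_eq_zero.2 (hI 3).symm)
    (by rw [dotProduct_sub, ← h₁, hrot, h₁]; exact sub_eq_zero.2 (hI 4).symm)
    (by
      have hmixed : (s 0).ω ⬝ᵥ (s 1).v + (s 1).ω ⬝ᵥ (s 0).v =
        (s' 0).ω ⬝ᵥ (s' 1).v + (s' 1).ω ⬝ᵥ (s' 0).v := hI 5
      rw [dotProduct_sub, dotProduct_sub, ← h₀, ← h₁, hrot, hrot, h₀, h₁]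
      linear_combination -hmixed)
  have hsmul {x y : Screw} (hω : M *ᵥ x.ω = y.ω) (hv : r ⨯₃ y.ω = y.v - M *ᵥ x.v) :
      (⟨⟨M, hM⟩, r⟩ : SE3) • x = y := by
    refine Screw.ext hω ?_
    rw [smul_v_eq_cross, smul_ω, hω, hv, sub_add_cancel]
  refine ⟨⟨⟨M, hM⟩, r⟩, funext fun i => ?_⟩
  fin_cases i
  exacts [hsmul h₀ hr₀, hsmul h₁ hr₁]

end Invariants

section NormalForm

variable {K : Type*} [Field K]

/-- The squared length of the component of `ω₁` orthogonal to `ω₂`, in terms of the invariants. -/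
def transverseSq (I : Fin 6 → K) : K := gramDet I / I 2

/-- The product of the components of `ω₁` and `v₁` orthogonal to `ω₂`, in terms of the invariants,
when `v₂` is parallel to `ω₂`. -/
def transverseDot (I : Fin 6 → K) : K := I 3 - I 1 * (I 5 - I 1 * I 4 / I 2) / I 2

/-- The coordinates of a pair of screws with invariants `I` whose second screw has the first
coordinate axis as its axis, and `ω₂ = (t, 0, 0)`; here `(x, y)` and `(p, q)` are the components of
`ω₁` and `v₁` orthogonal to this axis. -/
def axisPoint (I : Fin 6 → K) (t x y p q : K) : Coord 2 → K := fun c =>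
  ![Sum.elim ![I 1 / t, x, y] ![(I 5 - I 1 * I 4 / I 2) / t, p, q],
    Sum.elim ![t, 0, 0] ![I 4 / t, 0, 0]] c.1 c.2

variable {L : Type*} [Field L] (φ : K →+* L)

theorem map_transverseSq (I : Fin 6 → K) :
    φ (transverseSq I) = transverseSq fun i => φ (I i) := by
  simp [transverseSq, gramDet]

theorem map_transverseDot (I : Fin 6 → K) :
    φ (transverseDot I) = transverseDot fun i => φ (I i) := by
  simp [transverseDot]

theorem map_axisPoint (I : Fin 6 → K) (t x y p q : K)
    (c : Coord 2) : φ (axisPoint I t x y p q c) =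
      axisPoint (fun i => φ (I i)) (φ t) (φ x) (φ y) (φ p) (φ q) c := by
  obtain ⟨i, n | n⟩ := c <;> fin_cases i <;> fin_cases n <;> simp [axisPoint]

theorem invariants_axisPoint {I : Fin 6 → ℝ} {t x y p q : ℝ} (ht : t ^ 2 = I 2) (hI : I 2 ≠ 0)
    (hxy : x ^ 2 + y ^ 2 = transverseSq I) (hpq : x * p + y * q = transverseDot I) :
    invariants (ofCoords (axisPoint I t x y p q)) = I := by
  have ht₀ : t ≠ 0 := by
    rintro rfl
    exact hI (by rw [← ht, zero_pow two_ne_zero])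
  simp only [transverseSq, transverseDot, gramDet] at hxy hpq
  rw [← ht] at hxy hpq
  ext i
  fin_cases i
  · change ![I 1 / t, x, y] ⬝ᵥ ![I 1 / t, x, y] = I 0
    rw [vec3_dotProduct']
    field_simp at hxy ⊢
    linear_combination hxy
  · change ![I 1 / t, x, y] ⬝ᵥ ![t, 0, 0] = I 1
    rw [vec3_dotProduct']
    field_simp
    ring
  · change ![t, 0, 0] ⬝ᵥ ![t, 0, 0] = I 2
    rw [vec3_dotProduct', ← ht]
    ring
  · change ![I 1 / t, x, y] ⬝ᵥ ![(I 5 - I 1 * I 4 / I 2) / t, p, q] = I 3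
    rw [vec3_dotProduct', ← ht]
    field_simp at hpq ⊢
    linear_combination hpq
  · change ![t, 0, 0] ⬝ᵥ ![I 4 / t, 0, 0] = I 4
    rw [vec3_dotProduct']
    field_simp
    ring
  · change ![I 1 / t, x, y] ⬝ᵥ ![I 4 / t, 0, 0] +
      ![t, 0, 0] ⬝ᵥ ![(I 5 - I 1 * I 4 / I 2) / t, p, q] = I 5
    rw [vec3_dotProduct', vec3_dotProduct', ← ht]
    field_simp
    ring

theorem exists_invariants_eq {I : Fin 6 → ℝ} (hI : 0 < I 2) (hgram : 0 < gramDet I) :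
    ∃ s : Fin 2 → Screw, invariants s = I := by
  have hρ : 0 < transverseSq I := div_pos hgram hI
  exact ⟨_, invariants_axisPoint (x := √(transverseSq I)) (y := 0)
    (p := transverseDot I / √(transverseSq I)) (q := 0) (Real.sq_sqrt hI.le) hI.ne'
    (by rw [Real.sq_sqrt hρ.le]; ring)
    (by rw [mul_div_cancel₀ _ (Real.sqrt_ne_zero'.2 hρ)]; ring)⟩

theorem algebraicIndependent_gens : AlgebraicIndependent ℝ gens := by
  intro P Q hPQ
  refine MvPolynomial.funext_set
    (s := ![Set.Ioi 1, Set.Ioo 0 1, Set.Ioi 1, Set.univ, Set.univ, Set.univ]) ?_ fun I hI => ?_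
  · intro i
    fin_cases i
    exacts [Set.Ioi_infinite 1, Set.Ioo_infinite one_pos, Set.Ioi_infinite 1, Set.infinite_univ,
      Set.infinite_univ, Set.infinite_univ]
  · have h₀ : 1 < I 0 := hI 0 trivial
    have h₁ : 0 < I 1 ∧ I 1 < 1 := hI 1 trivial
    have h₂ : 1 < I 2 := hI 2 trivial
    obtain ⟨s, rfl⟩ := exists_invariants_eq (I := I) (by linarith) (by
      unfold gramDet
      nlinarith)
    rw [← eval_aeval_gens, ← eval_aeval_gens, hPQ]

theorem invariants_two_pos_and_gramDet_pos {s : Fin 2 → Screw} (h : gramDet (invariants s) ≠ 0) :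
    0 < invariants s 2 ∧ 0 < gramDet (invariants s) := by
  have hself (x : Fin 3 → ℝ) : 0 ≤ x ⬝ᵥ x := Fintype.sum_nonneg fun i => mul_self_nonneg (x i)
  have hgram : 0 < gramDet (invariants s) := by
    refine lt_of_le_of_ne ?_ h.symm
    have := hself ((s 0).ω ⨯₃ (s 1).ω)
    rwa [cross_dot_cross, dotProduct_comm (s 1).ω (s 0).ω, ← sq] at this
  refine ⟨lt_of_le_of_ne (hself (s 1).ω) fun h₂ => ?_, hgram⟩
  change 0 = invariants s 2 at h₂
  simp only [gramDet, ← h₂] at hgram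
  nlinarith

/-- The curve `z ↦ axisPoint I t (x z) (y z) (p z) (q z)` obtained from a real pair of screws by the
screw motions about the axis of the second screw with rotation angle and translation proportional
to `z`, where now `z` is complex. -/
noncomputable def screwCurve (I : Fin 6 → ℝ) (t : ℝ) (z : ℂ) : Coord 2 → ℂ :=
  let ρ : ℝ := √(transverseSq I)
  let θ : ℂ := z * Real.log ρ
  let κ : ℂ := (transverseDot I / ρ : ℝ)
  axisPoint (fun i => (I i : ℂ)) t (ρ * Complex.cos θ) (ρ * Complex.sin θ)
    (κ * (Complex.cos θ - z * Complex.sin θ)) (κ * (Complex.sin θ + z * Complex.cos θ))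

theorem analyticOnNhd_screwCurve (I : Fin 6 → ℝ) (t : ℝ) (c : Coord 2) :
    AnalyticOnNhd ℂ (fun z => screwCurve I t z c) Set.univ := by
  intro z _
  obtain ⟨i, n | n⟩ := c <;> fin_cases i <;> fin_cases n <;>
    simp only [screwCurve, axisPoint] <;> dsimp <;> fun_prop

theorem exists_screwCurve_ofReal_eq {I : Fin 6 → ℝ} (hI : 0 < I 2) (hgram : 0 < gramDet I) {t : ℝ}
    (ht : t ^ 2 = I 2) (z : ℝ) :
    ∃ s : Fin 2 → Screw, invariants s = I ∧ ∀ c, screwCurve I t z c = coords s c := by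
  set ρ := √(transverseSq I) with hρ
  set θ := z * Real.log ρ with hθ
  set κ := transverseDot I / ρ with hκ
  have hγ : 0 < transverseSq I := div_pos hgram hI
  have hρκ : ρ * κ = transverseDot I := mul_div_cancel₀ _ (Real.sqrt_ne_zero'.2 hγ)
  refine ⟨ofCoords (axisPoint I t (ρ * Real.cos θ) (ρ * Real.sin θ)
    (κ * (Real.cos θ - z * Real.sin θ)) (κ * (Real.sin θ + z * Real.cos θ))),
    invariants_axisPoint ht hI.ne' ?_ ?_, fun c => ?_⟩
  · linear_combination ρ ^ 2 * Real.cos_sq_add_sin_sq θ + Real.sq_sqrt hγ.le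
  · linear_combination ρ * κ * Real.cos_sq_add_sin_sq θ + hρκ
  · rw [coords_ofCoords]
    refine Eq.trans ?_ (map_axisPoint Complex.ofRealHom _ _ _ _ _ _ c).symm
    simp only [screwCurve, Complex.ofRealHom_eq_coe, ← hρ, ← hκ, hθ]
    push_cast
    rfl

/-- The complex normal form of a pair of screws with invariants `I`, in which the components
`(x, y)` and `(p, q)` of `ω₁` and `v₁` orthogonal to `ω₂` satisfy `x + i y = 1` and `p + i q = 0`;
unlike a real normal form, it involves no square root other than `t`. -/
noncomputable def isotropicPoint (I : Fin 6 → ℂ) (t : ℂ) : Coord 2 → ℂ :=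
  axisPoint I t ((transverseSq I + 1) / 2) (Complex.I * (transverseSq I - 1) / 2) (transverseDot I)
    (Complex.I * transverseDot I)

theorem screwCurve_I {I : Fin 6 → ℝ} (hI : 0 < transverseSq I) (t : ℝ) :
    screwCurve I t Complex.I = isotropicPoint (fun i => (I i : ℂ)) t := by
  have hρ : 0 < √(transverseSq I) := Real.sqrt_pos.2 hI
  have hρ₀ : (√(transverseSq I) : ℂ) ≠ 0 := Complex.ofReal_ne_zero.2 hρ.ne'
  have hρsq : transverseSq (fun i => (I i : ℂ)) = (√(transverseSq I) : ℂ) ^ 2 := by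
    rw [← Complex.ofReal_pow, Real.sq_sqrt hI.le]
    exact (map_transverseSq Complex.ofRealHom I).symm
  have hδ : transverseDot (fun i => (I i : ℂ)) = (transverseDot I : ℝ) :=
    (map_transverseDot Complex.ofRealHom I).symm
  have hcos : Complex.cos (Complex.I * Real.log √(transverseSq I)) =
      (√(transverseSq I) + (√(transverseSq I))⁻¹) / 2 := by
    rw [mul_comm, Complex.cos_mul_I, ← Complex.ofReal_cosh, Real.cosh_log hρ]
    push_cast
    rfl
  have hsin : Complex.sin (Complex.I * Real.log √(transverseSq I)) =
      Complex.I * (√(transverseSq I) - (√(transverseSq I))⁻¹) / 2 := by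
    rw [mul_comm, Complex.sin_mul_I, ← Complex.ofReal_sinh, Real.sinh_log hρ]
    push_cast
    ring
  simp only [screwCurve, isotropicPoint, hcos, hsin, hρsq, hδ]
  congr 1 <;> push_cast <;> field_simp
  · linear_combination (transverseDot I : ℝ) * (1 - (√(transverseSq I) : ℂ) ^ 2) * Complex.I_sq
  · ring

theorem eval_eq_aeval_isotropicPoint {f : MvPolynomial (Coord 2) ℝ} (hf : f ∈ invariantRing 2)
    {s : Fin 2 → Screw} (hgram : gramDet (invariants s) ≠ 0) {t : ℝ}
    (ht : t ^ 2 = invariants s 2) :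
    (eval (coords s) f : ℂ) = aeval (isotropicPoint (fun i => (invariants s i : ℂ)) t) f := by
  obtain ⟨hpos, hgram'⟩ := invariants_two_pos_and_gramDet_pos hgram
  have hreal (z : ℝ) : aeval (screwCurve (invariants s) t z) f = (eval (coords s) f : ℂ) := by
    obtain ⟨s', hs', hcurve⟩ := exists_screwCurve_ofReal_eq hpos hgram' ht z
    obtain ⟨g, rfl⟩ := exists_smul_eq_of_invariants_eq hs'.symm hgram
    rw [funext hcurve, ← hf g s, ← aeval_eq_eval]
    exact aeval_algebraMap_apply ℂ (coords (g • s)) f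
  rw [← screwCurve_I (div_pos hgram' hpos)]
  exact (eq_of_forall_ofReal_eq
    (AnalyticOnNhd.aeval_mvPolynomial (analyticOnNhd_screwCurve _ t) f) hreal Complex.I).symm

end NormalForm

section Denominators

theorem exists_sq_mul_isotropicPoint_eq (c : Coord 2) :
    ∃ G H : MvPolynomial (Fin 6) ℂ, ∀ (I : Fin 6 → ℂ) (t : ℂ), t ^ 2 = I 2 → t ≠ 0 →
      I 2 ^ 2 * isotropicPoint I t c = eval I G + t * eval I H := by
  let D : MvPolynomial (Fin 6) ℂ := X 2 ^ 2 * X 3 - X 1 * X 5 * X 2 + X 1 ^ 2 * X 4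
  let S : MvPolynomial (Fin 6) ℂ := X 2 * gramDet X
  refine ⟨![Sum.elim ![0, C (1 / 2) * (S + X 2 ^ 2), C (Complex.I / 2) * (S - X 2 ^ 2)]
      ![0, D, C Complex.I * D], 0] c.1 c.2,
    ![Sum.elim ![X 1 * X 2, 0, 0] ![X 5 * X 2 - X 1 * X 4, 0, 0],
      Sum.elim ![X 2 ^ 2, 0, 0] ![X 4 * X 2, 0, 0]] c.1 c.2, fun I t ht ht₀ => ?_⟩
  obtain ⟨i, n | n⟩ := c <;> fin_cases i <;> fin_cases n <;>
    simp [S, D, isotropicPoint, axisPoint, transverseSq, transverseDot, gramDet, ← ht] <;>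
    field_simp <;> ring

theorem exists_pow_mul_aeval_isotropicPoint_eq (f : MvPolynomial (Coord 2) ℝ) :
    ∃ (N : ℕ) (G H : MvPolynomial (Fin 6) ℂ), ∀ (I : Fin 6 → ℂ) (t : ℂ), t ^ 2 = I 2 → t ≠ 0 →
      I 2 ^ N * aeval (isotropicPoint I t) f = eval I G + t * eval I H := by
  let Θ := {θ : (Fin 6 → ℂ) × ℂ // θ.2 ^ 2 = θ.1 2 ∧ θ.2 ≠ 0}
  have hcoord (c : Coord 2) : ∃ G H : MvPolynomial (Fin 6) ℂ, ∀ θ : Θ,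
      eval θ.1.1 (X 2 ^ 2) * isotropicPoint θ.1.1 θ.1.2 c =
        eval θ.1.1 G + θ.1.2 * eval θ.1.1 H := by
    obtain ⟨G, H, h⟩ := exists_sq_mul_isotropicPoint_eq c
    exact ⟨G, H, fun θ => by simpa using h _ _ θ.2.1 θ.2.2⟩
  obtain ⟨N, G, H, h⟩ := exists_pow_mul_eval_eq_add_mul (c := X 2)
    (fun θ : Θ => by rw [eval_X, θ.2.1]) hcoord (map (algebraMap ℝ ℂ) f)
  refine ⟨2 * N, G, H, fun I t ht ht₀ => ?_⟩
  simpa only [eval_map, ← aeval_def, map_pow, eval_X, ← pow_mul] using h ⟨(I, t), ht, ht₀⟩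

theorem exists_gens_two_pow_mul_mem_range {f : MvPolynomial (Coord 2) ℝ}
    (hf : f ∈ invariantRing 2) : ∃ N, gens 2 ^ N * f ∈ (aeval (R := ℝ) gens).range := by
  obtain ⟨N, G, H, hGH⟩ := exists_pow_mul_aeval_isotropicPoint_eq f
  obtain ⟨Q, hQ⟩ := exists_eval_eq_re G
  refine ⟨N, Q, eq_of_eval_coords_eq fun s hs => ?_⟩
  have hpos := (invariants_two_pos_and_gramDet_pos hs).1
  have hvalue (t : ℝ) (ht : t ^ 2 = invariants s 2) :
      (invariants s 2 : ℂ) ^ N * eval (coords s) f =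
        eval (fun i => (invariants s i : ℂ)) G + t * eval (fun i => (invariants s i : ℂ)) H := by
    have ht₀ : t ≠ 0 := by
      rintro rfl
      simp [← ht] at hpos
    rw [eval_eq_aeval_isotropicPoint hf hs ht]
    exact hGH (fun i => invariants s i) t (by exact_mod_cast ht) (by exact_mod_cast ht₀)
  have hsqrt := Real.sq_sqrt hpos.le
  have hplus := hvalue √(invariants s 2) hsqrt
  have hminus := hvalue (-√(invariants s 2)) (by rw [neg_sq, hsqrt])
  have hG : (invariants s 2 : ℂ) ^ N * eval (coords s) f =
      eval (fun i => (invariants s i : ℂ)) G := by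
    push_cast at hminus
    linear_combination (hplus + hminus) / 2
  change eval (coords s) (aeval gens Q) = _
  rw [eval_aeval_gens, hQ, ← hG, map_mul, map_pow, eval_gens]
  norm_cast

end Denominators

section Swap

theorem rename_mem_invariantRing {k l : ℕ} (τ : Fin k → Fin l) {f : MvPolynomial (Coord k) ℝ}
    (hf : f ∈ invariantRing k) : rename (Prod.map τ id) f ∈ invariantRing l := by
  intro g s
  rw [eval_rename, eval_rename]
  exact hf g (s ∘ τ)

theorem rename_swap_gens (i : Fin 6) :
    rename (Prod.map (Equiv.swap (0 : Fin 2) 1) id) (gens i) = gens (![2, 1, 0, 4, 3, 5] i) := by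
  fin_cases i <;> simp [gens, omegaVar, vVar, dotProduct, Fin.sum_univ_three] <;> ring

theorem rename_swap_mem_range {f : MvPolynomial (Coord 2) ℝ}
    (hf : f ∈ (aeval (R := ℝ) gens).range) :
    rename (Prod.map (Equiv.swap (0 : Fin 2) 1) id) f ∈ (aeval (R := ℝ) gens).range := by
  obtain ⟨P, rfl⟩ := hf
  refine ⟨rename ![2, 1, 0, 4, 3, 5] P, ?_⟩
  change aeval gens _ = rename _ (aeval gens P)
  rw [aeval_rename, comp_aeval_apply, funext rename_swap_gens]
  rfl

theorem exists_gens_zero_pow_mul_mem_range {f : MvPolynomial (Coord 2) ℝ}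
    (hf : f ∈ invariantRing 2) : ∃ N, gens 0 ^ N * f ∈ (aeval (R := ℝ) gens).range := by
  obtain ⟨N, hN⟩ := exists_gens_two_pow_mul_mem_range
    (rename_mem_invariantRing (Equiv.swap 0 1) hf)
  refine ⟨N, ?_⟩
  have h := rename_swap_mem_range hN
  rwa [map_mul, map_pow, rename_swap_gens, rename_rename, Prod.map_comp_map, ← Equiv.Perm.coe_mul,
    Equiv.swap_mul_self, Equiv.Perm.coe_one, Function.id_comp, Prod.map_id, rename_id_apply] at h

end Swap

end Screws

/-- The ring of invariants of `SE(3)` on pairs of screws is generated by the `ωᵢ · ωⱼ`, the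
`ωᵢ · vᵢ` and `ω₁ · v₂ + ω₂ · v₁` (indices `1, 2` are `0, 1 : Fin 2`). -/
theorem theorem4 :
    Screws.invariantRing 2 =
      Algebra.adjoin ℝ
        ({p | ∃ i j : Fin 2, p = Screws.omegaVar i ⬝ᵥ Screws.omegaVar j} ∪
          {p | ∃ i : Fin 2, p = Screws.omegaVar i ⬝ᵥ Screws.vVar i} ∪
          {Screws.omegaVar 0 ⬝ᵥ Screws.vVar 1 + Screws.omegaVar 1 ⬝ᵥ Screws.vVar 0}) := by
  rw [Screws.adjoin_eq_range_aeval_gens]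
  refine le_antisymm (fun f hf => ?_) Screws.range_aeval_gens_le
  obtain ⟨m, hm⟩ := Screws.exists_gens_two_pow_mul_mem_range hf
  obtain ⟨n, hn⟩ := Screws.exists_gens_zero_pow_mul_mem_range hf
  have hcoprime : ¬(X 2 : MvPolynomial (Fin 6) ℝ) ∣ X 0 := by simp [X_dvd_X]
  refine Screws.mem_range_of_pow_mul_mem_range (φ := (aeval (R := ℝ) Screws.gens).toRingHom)
    Screws.algebraicIndependent_gens X_prime hcoprime (m := m) (n := n) ?_ ?_
  · simpa using hm
  · simpa using hn
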